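/- Let $h_1,\dots,h_m\in\mathbb R[x]=\mathbb R[x_1,\dots,x_n]$, let $I=\langle h_1,\dots,h_m\rangle$, and let $d_j=\lceil \deg(h_j)/2\rceil$ (with $\deg 0:=0$) and $d=\max_j d_j$. Let $V_{\mathbb R}(I)\subseteq\mathbb R^n$ be the set of common real zeros of $I$, and for $V\subseteq\mathbb R^n$ let $I(V)$ be the ideal of polynomials in $\mathbb R[x]$ vanishing on $V$. For a real sequence $y=(y_\alpha)$ and $s\ge 0$, let $M_s(y)=(y_{\alpha+\beta})_{|\alpha|,|\beta|\le s}$ be the truncated moment matrix, let $(h_jy)_\alpha=\sum_\beta (h_j)_\beta\, y_{\alpha+\beta}$, and regard $\mathrm{Ker}\,M_s(y)$ as the set of polynomials of degree at most $s$ whose coefficient vector lies in the kernel of $M_s(y)$. For $t\ge d$ let $$K_t^{\mathbb R}=\{y\in\mathbb R^{\{\alpha\in\mathbb N^n:\,|\alpha|\le 2t\}} : y_0=1,\ M_t(y)\succeq 0,\ M_{t-d_j}(h_jy)=0\ (j=1,\dots,m)\}.$$ Let $t\ge d$ and let $y\in K_t^{\mathbb R}$ be such that $\mathrm{rank}\,M_t(y)$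 is maximum over $K_t^{\mathbb R}$. Let $s\le t$ and assume that either * $s\ge 1$, $s\ge 2d$ and $\mathrm{rank}\,M_s(y)=\mathrm{rank}\,M_{s-1}(y)$, or * $s\ge d$ and $\mathrm{rank}\,M_s(y)=\mathrm{rank}\,M_{s-d}(y)$. Then $I(V_{\mathbb R}(I))$ is the ideal $\langle \mathrm{Ker}\,M_s(y)\rangle$ of $\mathbb R[x]$ generated by $\mathrm{Ker}\,M_s(y)$. Moreover, unless $n\ge 1$ and $h_1=\dots=h_m=0$, the set $V_{\mathbb R}(I)$ is finite, $\mathrm{rank}\,M_s(y)=|V_{\mathbb R}(I)|$, and $V_{\mathbb R}(I)$ can be recovered from $M_s(y)$ as the set of all common complex zeros of $\langle \mathrm{Ker}\,M_s(y)\rangle$ (in particular, these zeros are all real). -/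

import Mathlib

namespace MomentRealRadical

open MvPolynomial

/-- The multi-indices `α ∈ ℕⁿ` with `|α| = ∑ᵢ αᵢ ≤ k` (equivalently, the monomials of degree at most
`k` in `n` variables). -/
abbrev MultiIndex (n k : ℕ) : Type := {α : Fin n →₀ ℕ // α.degree ≤ k}

noncomputable instance instFintypeMultiIndex (n k : ℕ) : Fintype (MultiIndex n k) :=
  (Finsupp.finite_of_degree_le (σ := Fin n) k).fintype

/-- The truncated moment matrix `M_s(y)`, with `(α, β)` entry `y_{α+β}` for `|α|, |β| ≤ s`. -/
noncomputable def momentMatrix {n : ℕ} (s : ℕ) (y : (Fin n →₀ ℕ) → ℝ) :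
    Matrix (MultiIndex n s) (MultiIndex n s) ℝ :=
  Matrix.of fun α β => y (α.1 + β.1)

/-- The sequence `h y`, with `(h y)_α = ∑_β h_β y_{α+β}`. -/
noncomputable def shift {n : ℕ} (h : MvPolynomial (Fin n) ℝ) (y : (Fin n →₀ ℕ) → ℝ) :
    (Fin n →₀ ℕ) → ℝ :=
  fun α => ∑ β ∈ h.support, h.coeff β * y (α + β)

/-- `d_h = ⌈deg h / 2⌉`. -/
noncomputable def halfDeg {n : ℕ} (h : MvPolynomial (Fin n) ℝ) : ℕ := (h.totalDegree + 1) / 2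

/-- `d = max_j d_{h_j}` (and `0` for an empty family). -/
noncomputable def maxHalfDeg {n m : ℕ} (h : Fin m → MvPolynomial (Fin n) ℝ) : ℕ :=
  Finset.univ.sup fun j => halfDeg (h j)

/-- A truncated sequence, extended by zero to all of `ℕⁿ`. The matrices below only involve entries
`y_γ` with `|γ| ≤ k`, so the values outside the truncation play no role. -/
noncomputable def extend {n k : ℕ} (y : MultiIndex n k → ℝ) : (Fin n →₀ ℕ) → ℝ :=
  fun γ => if hγ : γ.degree ≤ k then y ⟨γ, hγ⟩ else 0

/-- The set `K_t` of truncated sequences `y = (y_α)_{|α| ≤ 2t}` with `y_0 = 1`, `M_t(y) ⪰ 0` and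
`M_{t - d_j}(h_j y) = 0` for all `j`. It is used for `t ≥ max_j d_j` only. -/
noncomputable def feasibleSet {n m : ℕ} (h : Fin m → MvPolynomial (Fin n) ℝ) (t : ℕ) :
    Set (MultiIndex n (2 * t) → ℝ) :=
  {y | extend y 0 = 1 ∧ (momentMatrix t (extend y)).PosSemidef ∧
    ∀ j, momentMatrix (t - halfDeg (h j)) (shift (h j) (extend y)) = 0}

/-- `Ker M_s(y)` as a set of polynomials: those of degree at most `s` whose coefficient vector
`(p_α)_{|α| ≤ s}` is annihilated by `M_s(y)`. -/
def momentKernel {n : ℕ} (s : ℕ) (y : (Fin n →₀ ℕ) → ℝ) : Set (MvPolynomial (Fin n) ℝ) :=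
  {p | p.totalDegree ≤ s ∧
    (momentMatrix s y).mulVec (fun α : MultiIndex n s => p.coeff α.1) = 0}

end MomentRealRadical

/-! Let L be the functional x^α ↦ y_α. Positivity of M_s(y) makes (p, q) ↦ L(pq) an inner product on
the polynomials of degree at most s modulo Ker M_s(y). When d > 0, the rank condition says that
degrees below s already fill this space, so multiplication by each variable acts on it; these
operators are symmetric and commute. Splitting the class of 1 along their joint eigenspaces gives a
finite set S of real points and weights w_γ > 0 with L(p) = ∑ w_γ p(γ) in degree at most 2s
(`exists_atoms`, `exists_atoms_of_rank_eq`). Then Ker M_s(y) is exactly what vanishes on S in degree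
at most s, and interpolation in degree below s shows that it generates I(S)
(`span_eq_vanishingIdeal`).

It remains to identify S with the real variety. Averaging y with the moments of a point of the
variety stays feasible and can only shrink the kernel; maximality of the rank forbids this, so the
kernel vanishes at the point (`eval_eq_zero_of_mem_momentKernel`). Conversely the constraints L(h_j
q) = 0 either put h_j in the kernel or, tested on squares of interpolation polynomials, give h_j(γ)
= 0 (`eval_eq_zero_of_flat`).

If d = 0 the second rank condition is empty; then y_0 = 1 forces every h_j to be zero, and the claim
is checked directly. -/

namespace MomentRealRadical

open MvPolynomial

/-! ### Joint diagonalisation of the multiplication operators. -/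

section Core

variable {n : ℕ}

theorem eq_of_eq_monomial {E : Type*} [AddCommGroup E] [Module ℝ E]
    (f g : MvPolynomial (Fin n) ℝ →ₗ[ℝ] E) {s : ℕ}
    (H : ∀ α : Fin n →₀ ℕ, α.degree ≤ s → f (monomial α 1) = g (monomial α 1))
    {p : MvPolynomial (Fin n) ℝ} (hp : p.totalDegree ≤ s) : f p = g p := by
  rw [p.as_sum, map_sum, map_sum]
  refine Finset.sum_congr rfl fun α hα => ?_
  have h1 : monomial α (p.coeff α) = p.coeff α • (monomial α (1 : ℝ)) := by
    rw [smul_monomial, smul_eq_mul, mul_one]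
  rw [h1, map_smul, map_smul, H α ((le_totalDegree hα).trans hp)]

theorem totalDegree_monomial_one_le (α : Fin n →₀ ℕ) :
    (monomial α (1 : ℝ)).totalDegree ≤ α.degree :=
  totalDegree_monomial_le α 1

theorem totalDegree_X_mul_le {s : ℕ} (i : Fin n) {p : MvPolynomial (Fin n) ℝ}
    (hp : p.totalDegree + 1 ≤ s) : (X i * p).totalDegree ≤ s := by
  refine (totalDegree_mul _ _).trans ?_
  rw [totalDegree_X]; omega

theorem totalDegree_sub_le {s : ℕ} {p q : MvPolynomial (Fin n) ℝ}
    (hp : p.totalDegree ≤ s) (hq : q.totalDegree ≤ s) : (p - q).totalDegree ≤ s :=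
  (totalDegree_sub _ _).trans (max_le hp hq)

/-- A monomial of positive degree is a variable times a monomial of smaller degree. -/
theorem exists_monomial_eq_X_mul {α : Fin n →₀ ℕ} {k : ℕ} (hα : α.degree = k + 1) :
    ∃ (i : Fin n) (β : Fin n →₀ ℕ), β.degree = k ∧
      (monomial α 1 : MvPolynomial (Fin n) ℝ) = X i * monomial β 1 := by
  have hne : α ≠ 0 := by rintro rfl; simp at hα
  obtain ⟨i, hi⟩ := Finsupp.ne_iff.mp hne
  have hle : Finsupp.single i 1 ≤ α := by
    rw [Finsupp.single_le_iff]; exact Nat.one_le_iff_ne_zero.mpr hi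
  obtain ⟨β, rfl⟩ := exists_add_of_le hle
  refine ⟨i, β, ?_, ?_⟩
  · rw [map_add, Finsupp.degree_single] at hα; omega
  · rw [X, monomial_mul, one_mul]

variable {E : Type*} [NormedAddCommGroup E] [InnerProductSpace ℝ E] [FiniteDimensional ℝ E]

/-- A Gram representation of a flat truncated moment functional is given by evaluation at finitely
many points with orthogonal weights. -/
theorem exists_atoms (φ : MvPolynomial (Fin n) ℝ →ₗ[ℝ] E) (L : MvPolynomial (Fin n) ℝ →ₗ[ℝ] ℝ)
    {s k : ℕ} (hks : k + 1 = s)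
    (hL : ∀ p q, p.totalDegree ≤ s → q.totalDegree ≤ s → inner ℝ (φ p) (φ q) = L (p * q))
    (hsurj : ∀ e, ∃ p, p.totalDegree ≤ k ∧ φ p = e) :
    ∃ f : (Fin n → ℝ) →₀ E, (∀ γ γ', γ ≠ γ' → inner ℝ (f γ) (f γ') = 0) ∧
      ∀ p, p.totalDegree ≤ s → φ p = f.sum fun γ v => eval γ p • v := by
  classical
  have hks' : k ≤ s := by omega
  -- multiplication by a variable preserves the kernel
  have hker : ∀ i p, p.totalDegree ≤ k → φ p = 0 → φ (X i * p) = 0 := by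
    intro i p hp hp0
    -- The low-degree q represents `φ (X i * p)` itself, so the inner product below is a squared
    -- norm, and there is room in degree s to move `X i` onto q.
    obtain ⟨q, hq, hqe⟩ := hsurj (φ (X i * p))
    have h1 : inner ℝ (φ (X i * p)) (φ q) = (0 : ℝ) := by
      rw [hL _ _ (totalDegree_X_mul_le _ (by omega)) (hq.trans hks'),
        show X i * p * q = p * (X i * q) by ring,
        ← hL _ _ (hp.trans hks') (totalDegree_X_mul_le _ (by omega)), hp0, inner_zero_left]
    rw [hqe] at h1
    exact inner_self_eq_zero.mp h1
  let P := restrictTotalDegree (Fin n) ℝ k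
  let φk : P →ₗ[ℝ] E := φ ∘ₗ P.subtype
  have hφk : LinearMap.range φk = ⊤ := by
    rw [LinearMap.range_eq_top]
    intro e
    obtain ⟨p, hp, hpe⟩ := hsurj e
    exact ⟨⟨p, (mem_restrictTotalDegree _ _ _).mpr hp⟩, hpe⟩
  -- The section σ picks representatives of degree at most k; by `hker` the operators do not depend
  -- on this choice.
  obtain ⟨σ, hσ⟩ := φk.exists_rightInverse_of_surjective hφk
  let T : Fin n → E →ₗ[ℝ] E := fun i =>
    φ ∘ₗ (LinearMap.mulLeft ℝ (X i : MvPolynomial (Fin n) ℝ)) ∘ₗ P.subtype ∘ₗ σ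
  have hT : ∀ i p, p.totalDegree ≤ k → T i (φ p) = φ (X i * p) := by
    intro i p hp
    have h1 : φ (σ (φ p)).1 = φ p := LinearMap.congr_fun hσ (φ p)
    have h2 := hker i ((σ (φ p)).1 - p)
      (totalDegree_sub_le ((mem_restrictTotalDegree _ _ _).mp (σ (φ p)).2) hp)
      (by rw [map_sub, h1, sub_self])
    rw [mul_sub, map_sub, sub_eq_zero] at h2
    exact h2
  have hTin : ∀ i p q, p.totalDegree ≤ k → q.totalDegree ≤ k →
      inner ℝ (T i (φ p)) (φ q) = L (X i * (p * q)) := by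
    intro i p q hp hq
    rw [hT i p hp, hL _ _ (totalDegree_X_mul_le i (by omega)) (hq.trans hks'), mul_assoc]
  have hTs : ∀ i, (T i).IsSymmetric := by
    intro i u v
    obtain ⟨p, hp, rfl⟩ := hsurj u
    obtain ⟨q, hq, rfl⟩ := hsurj v
    rw [hTin i p q hp hq, real_inner_comm, hTin i q p hq hp, mul_comm p q]
  have hTc : Pairwise (Function.onFun Commute T) := by
    intro i j _
    refine LinearMap.ext fun u => ext_inner_right ℝ fun v => ?_
    obtain ⟨p, hp, rfl⟩ := hsurj u
    obtain ⟨q, hq, rfl⟩ := hsurj v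
    change inner ℝ (T i (T j (φ p))) (φ q) = inner ℝ (T j (T i (φ p))) (φ q)
    -- `X i * X j * p` may exceed degree s, so symmetry first moves one variable to the other side.
    rw [hTs i (T j (φ p)), hTs j (T i (φ p)), hT j _ hp, hT i _ hp, hT i _ hq, hT j _ hq,
      hL _ _ (totalDegree_X_mul_le _ (by omega)) (totalDegree_X_mul_le _ (by omega)),
      hL _ _ (totalDegree_X_mul_le _ (by omega)) (totalDegree_X_mul_le _ (by omega))]
    congr 1; ring
  have h1 : φ 1 ∈ ⨆ χ : Fin n → ℝ, ⨅ i, Module.End.eigenspace (T i) (χ i) := by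
    rw [LinearMap.IsSymmetric.iSup_iInf_eq_top_of_commute hTs hTc]; trivial
  obtain ⟨f, hf, hf1⟩ := (Submodule.mem_iSup_iff_exists_finsupp _ _).mp h1
  have hfe : ∀ γ i, T i (f γ) = γ i • f γ := fun γ i =>
    Module.End.mem_eigenspace_iff.mp ((Submodule.mem_iInf _).mp (hf γ) i)
  refine ⟨f, ?_, ?_⟩
  · intro γ γ' hne
    obtain ⟨i, hi⟩ := Function.ne_iff.mp hne
    have := hTs i (f γ) (f γ')
    rw [hfe, hfe, real_inner_smul_left, real_inner_smul_right, ← sub_eq_zero, ← sub_mul] at this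
    exact (mul_eq_zero.mp this).resolve_left (sub_ne_zero.mpr hi)
  · have hmon : ∀ (j : ℕ) (α : Fin n →₀ ℕ), α.degree = j → j ≤ s →
        φ (monomial α 1) = ∑ γ ∈ f.support, eval γ (monomial α (1 : ℝ)) • f γ := by
      intro j
      induction j with
      | zero =>
        intro α hα _
        obtain rfl := (Finsupp.degree_eq_zero_iff α).mp hα
        simpa [Finsupp.sum] using hf1.symm
      | succ j ih =>
        intro α hα hj
        obtain ⟨i, β, hβ, hαβ⟩ := exists_monomial_eq_X_mul hα
        rw [hαβ, ← hT i _ ((totalDegree_monomial_one_le β).trans (by omega)), ih β hβ (by omega),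
          map_sum]
        refine Finset.sum_congr rfl fun γ _ => ?_
        rw [map_smul, hfe, smul_smul, map_mul, eval_X, mul_comm]
    intro p hp
    let g : MvPolynomial (Fin n) ℝ →ₗ[ℝ] E :=
      ∑ γ ∈ f.support, ((aeval γ : MvPolynomial (Fin n) ℝ →ₐ[ℝ] ℝ).toLinearMap).smulRight (f γ)
    have hg : ∀ p, g p = ∑ γ ∈ f.support, eval γ p • f γ := by
      intro p
      simp [g, LinearMap.sum_apply]
    rw [Finsupp.sum, ← hg]
    exact eq_of_eq_monomial φ g (fun α hα => by rw [hg, hmon _ α rfl hα]) hp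

end Core

/-! ### Gram matrices and kernels of positive semidefinite matrices. -/

section Gram

variable {κ E : Type*} [Fintype κ] [NormedAddCommGroup E] [InnerProductSpace ℝ E]

theorem rank_gram (v : κ → E) :
    (Matrix.gram ℝ v).rank = Module.finrank ℝ (Submodule.span ℝ (Set.range v)) := by
  classical
  let g : (κ → ℝ) →ₗ[ℝ] E := Fintype.linearCombination ℝ v
  have hker : LinearMap.ker (Matrix.gram ℝ v).mulVecLin = LinearMap.ker g := by
    ext x
    simp only [LinearMap.mem_ker, Matrix.mulVecLin_apply]
    have h0 := Matrix.star_dotProduct_gram_mulVec (𝕜 := ℝ) v x x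
    rw [← (Matrix.posSemidef_gram ℝ v).dotProduct_mulVec_zero_iff, h0, inner_self_eq_zero]
    rfl
  have h1 := LinearMap.finrank_range_add_finrank_ker (Matrix.gram ℝ v).mulVecLin
  have h2 := LinearMap.finrank_range_add_finrank_ker g
  rw [Fintype.range_linearCombination] at h2
  rw [hker] at h1
  rw [Matrix.rank]
  omega

open scoped MatrixOrder in
theorem exists_gram_eq {A : Matrix κ κ ℝ} (hA : A.PosSemidef) :
    ∃ v : κ → EuclideanSpace ℝ κ, A = Matrix.gram ℝ v := by
  classical
  obtain ⟨B, rfl⟩ := CStarAlgebra.nonneg_iff_eq_star_mul_self.mp hA.nonneg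
  refine ⟨fun i => WithLp.toLp 2 (fun j => B j i), ?_⟩
  ext i j
  simp [Matrix.mul_apply, Matrix.star_eq_conjTranspose, PiLp.inner_apply, mul_comm]

-- For positive semidefinite matrices the kernel of a sum is the intersection of the kernels. The
-- rank bound leaves no room for this intersection to be smaller than the kernel of A.
open Matrix in
theorem mulVec_eq_zero_of_rank_midpoint_le {A B : Matrix κ κ ℝ} (hA : A.PosSemidef)
    (hB : B.PosSemidef) (hr : ((1 / 2 : ℝ) • (A + B)).rank ≤ A.rank) {x : κ → ℝ}
    (hx : A *ᵥ x = 0) : B *ᵥ x = 0 := by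
  classical
  have hmem : ∀ u : κ → ℝ, ((1 / 2 : ℝ) • (A + B)) *ᵥ u = 0 → A *ᵥ u = 0 ∧ B *ᵥ u = 0 := by
    intro u hu
    rw [smul_mulVec, smul_eq_zero_iff_right (by norm_num), add_mulVec] at hu
    have h1 := hA.dotProduct_mulVec_nonneg u
    have h2 := hB.dotProduct_mulVec_nonneg u
    have h3 : star u ⬝ᵥ A *ᵥ u + star u ⬝ᵥ B *ᵥ u = 0 := by
      rw [← dotProduct_add, hu, dotProduct_zero]
    rw [← hA.dotProduct_mulVec_zero_iff, ← hB.dotProduct_mulVec_zero_iff]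
    constructor <;> linarith
  have hle : LinearMap.ker ((1 / 2 : ℝ) • (A + B)).mulVecLin ≤ LinearMap.ker A.mulVecLin :=
    fun u hu => (hmem u hu).1
  have h1 := LinearMap.finrank_range_add_finrank_ker ((1 / 2 : ℝ) • (A + B)).mulVecLin
  have h2 := LinearMap.finrank_range_add_finrank_ker A.mulVecLin
  rw [Matrix.rank, Matrix.rank] at hr
  have heq := Submodule.eq_of_le_of_finrank_le hle (by omega)
  have hx' : x ∈ LinearMap.ker ((1 / 2 : ℝ) • (A + B)).mulVecLin := heq ▸ hx
  exact (hmem x hx').2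

end Gram

/-! ### Moment matrices as bilinear forms on polynomials. -/

section Moment

variable {n : ℕ}

/-- The linear functional `x^α ↦ y_α`. -/
noncomputable def riesz (y : (Fin n →₀ ℕ) → ℝ) : MvPolynomial (Fin n) ℝ →ₗ[ℝ] ℝ :=
  (basisMonomials (Fin n) ℝ).constr ℝ y

theorem riesz_monomial (y : (Fin n →₀ ℕ) → ℝ) (α : Fin n →₀ ℕ) :
    riesz y (monomial α 1) = y α :=
  (basisMonomials (Fin n) ℝ).constr_basis ℝ y α

theorem shift_apply (h : MvPolynomial (Fin n) ℝ) (y : (Fin n →₀ ℕ) → ℝ) (α : Fin n →₀ ℕ) :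
    shift h y α = riesz y (h * monomial α 1) := by
  conv_rhs => rw [h.as_sum]
  rw [Finset.sum_mul, map_sum, shift]
  refine Finset.sum_congr rfl fun β _ => ?_
  have : monomial β (h.coeff β) * monomial α 1 = h.coeff β • monomial (α + β) (1 : ℝ) := by
    rw [monomial_mul, smul_monomial, smul_eq_mul, add_comm]
  rw [this, map_smul, riesz_monomial, smul_eq_mul]

theorem exists_add_of_degree_le (a b : ℕ) (α : Fin n →₀ ℕ) (hα : α.degree ≤ a + b) :
    ∃ β γ : Fin n →₀ ℕ, β.degree ≤ a ∧ γ.degree ≤ b ∧ α = β + γ := by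
  induction a generalizing α with
  | zero => exact ⟨0, α, by simp, by omega, by simp⟩
  | succ a ih =>
    by_cases h0 : α = 0
    · exact ⟨0, 0, by simp, by simp, by simp [h0]⟩
    · obtain ⟨i, hi⟩ := Finsupp.ne_iff.mp h0
      have hle : Finsupp.single i 1 ≤ α := by
        rw [Finsupp.single_le_iff]; exact Nat.one_le_iff_ne_zero.mpr hi
      obtain ⟨δ, rfl⟩ := exists_add_of_le hle
      rw [map_add, Finsupp.degree_single] at hα
      obtain ⟨β, γ, hβ, hγ, rfl⟩ := ih δ (by omega)
      refine ⟨Finsupp.single i 1 + β, γ, ?_, hγ, by rw [add_assoc]⟩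
      rw [map_add, Finsupp.degree_single]; omega

/-- Two linear maps that agree on products of polynomials of degree at most `k` agree on
polynomials of degree at most `2k`. -/
theorem eq_of_eq_mul {E : Type*} [AddCommGroup E] [Module ℝ E]
    (f g : MvPolynomial (Fin n) ℝ →ₗ[ℝ] E) {k : ℕ}
    (H : ∀ p q : MvPolynomial (Fin n) ℝ, p.totalDegree ≤ k → q.totalDegree ≤ k →
      f (p * q) = g (p * q))
    {p : MvPolynomial (Fin n) ℝ} (hp : p.totalDegree ≤ 2 * k) : f p = g p := by
  refine eq_of_eq_monomial f g (fun α hα => ?_) hp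
  obtain ⟨β, γ, hβ, hγ, rfl⟩ := exists_add_of_degree_le k k α (by omega)
  have h1 : (monomial (β + γ) 1 : MvPolynomial (Fin n) ℝ) = monomial β 1 * monomial γ 1 := by
    rw [monomial_mul, one_mul]
  rw [h1]
  exact H _ _ ((totalDegree_monomial_one_le _).trans hβ) ((totalDegree_monomial_one_le _).trans hγ)

theorem map_eq_sum_multiIndex {E : Type*} [AddCommGroup E] [Module ℝ E]
    (f : MvPolynomial (Fin n) ℝ →ₗ[ℝ] E) {s : ℕ} {p : MvPolynomial (Fin n) ℝ}
    (hp : p.totalDegree ≤ s) :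
    f p = ∑ β : MultiIndex n s, p.coeff β.1 • f (monomial β.1 1) := by
  classical
  have h := eq_of_eq_monomial f
    (∑ β : MultiIndex n s, (lcoeff ℝ β.1).smulRight (f (monomial β.1 1))) (s := s) ?_ hp
  · simpa [LinearMap.sum_apply, lcoeff] using h
  · intro α hα
    rw [LinearMap.sum_apply, Finset.sum_eq_single ⟨α, hα⟩]
    · simp [lcoeff]
    · intro β _ hβ
      have : α ≠ β.1 := fun h => hβ (Subtype.ext h.symm)
      simp [lcoeff, coeff_monomial, this]
    · simp

open Matrix in
theorem momentMatrix_mulVec (y : (Fin n →₀ ℕ) → ℝ) {s : ℕ} {p : MvPolynomial (Fin n) ℝ}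
    (hp : p.totalDegree ≤ s) (α : MultiIndex n s) :
    (momentMatrix s y *ᵥ fun β : MultiIndex n s => p.coeff β.1) α =
      riesz y (monomial α.1 1 * p) := by
  have := map_eq_sum_multiIndex (riesz y ∘ₗ LinearMap.mulLeft ℝ (monomial α.1 1)) hp
  simp only [LinearMap.comp_apply, LinearMap.mulLeft_apply, monomial_mul, one_mul,
    riesz_monomial] at this
  rw [this]
  simp [mulVec, dotProduct, momentMatrix, mul_comm]

open Matrix in
theorem dotProduct_momentMatrix_mulVec (y : (Fin n →₀ ℕ) → ℝ) {s : ℕ}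
    {p q : MvPolynomial (Fin n) ℝ} (hp : p.totalDegree ≤ s) (hq : q.totalDegree ≤ s) :
    (fun β : MultiIndex n s => p.coeff β.1) ⬝ᵥ
      (momentMatrix s y *ᵥ fun β : MultiIndex n s => q.coeff β.1) = riesz y (p * q) := by
  have := map_eq_sum_multiIndex (riesz y ∘ₗ LinearMap.mulRight ℝ q) hp
  simp only [LinearMap.comp_apply, LinearMap.mulRight_apply] at this
  rw [this]
  simp [dotProduct, momentMatrix_mulVec y hq]

theorem riesz_mul_eq_zero_of_mem_momentKernel {y : (Fin n →₀ ℕ) → ℝ} {s : ℕ}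
    {p q : MvPolynomial (Fin n) ℝ} (hp : p ∈ momentKernel s y) (hq : q.totalDegree ≤ s) :
    riesz y (q * p) = 0 := by
  rw [← dotProduct_momentMatrix_mulVec y hq hp.1, hp.2, dotProduct_zero]

theorem mem_momentKernel_of_riesz {y : (Fin n →₀ ℕ) → ℝ} {s : ℕ} {p : MvPolynomial (Fin n) ℝ}
    (hp : p.totalDegree ≤ s)
    (h : ∀ q : MvPolynomial (Fin n) ℝ, q.totalDegree ≤ s → riesz y (q * p) = 0) :
    p ∈ momentKernel s y := by
  refine ⟨hp, funext fun α => ?_⟩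
  rw [momentMatrix_mulVec y hp]
  exact h _ ((totalDegree_monomial_one_le _).trans α.2)

theorem mem_momentKernel_of_riesz_self {y : (Fin n →₀ ℕ) → ℝ} {s : ℕ}
    (hy : (momentMatrix s y).PosSemidef) {p : MvPolynomial (Fin n) ℝ}
    (hp : p.totalDegree ≤ s) (h : riesz y (p * p) = 0) : p ∈ momentKernel s y :=
  ⟨hp, (hy.dotProduct_mulVec_zero_iff _).mp (by
    rw [star_trivial, dotProduct_momentMatrix_mulVec y hp hp, h])⟩

theorem momentMatrix_eq_submatrix (y : (Fin n →₀ ℕ) → ℝ) {k s : ℕ} (hks : k ≤ s) :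
    momentMatrix k y = (momentMatrix s y).submatrix
      (fun α : MultiIndex n k => (⟨α.1, α.2.trans hks⟩ : MultiIndex n s))
      (fun α : MultiIndex n k => (⟨α.1, α.2.trans hks⟩ : MultiIndex n s)) := rfl

theorem posSemidef_momentMatrix_of_le {y : (Fin n →₀ ℕ) → ℝ} {k s : ℕ} (hks : k ≤ s)
    (hy : (momentMatrix s y).PosSemidef) : (momentMatrix k y).PosSemidef := by
  rw [momentMatrix_eq_submatrix y hks]
  exact hy.submatrix _

/-- In the positive semidefinite case membership in the kernel is the single condition L(p²) = 0,
which does not involve the truncation order. -/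
theorem momentKernel_mono {y : (Fin n →₀ ℕ) → ℝ} {k s : ℕ} (hks : k ≤ s)
    (hy : (momentMatrix s y).PosSemidef) : momentKernel k y ⊆ momentKernel s y := fun _ hp =>
  mem_momentKernel_of_riesz_self hy (hp.1.trans hks)
    (riesz_mul_eq_zero_of_mem_momentKernel hp hp.1)

/-- Gram representation of a positive semidefinite truncated moment matrix. -/
theorem exists_gram_representation {y : (Fin n →₀ ℕ) → ℝ} {s : ℕ}
    (hy : (momentMatrix s y).PosSemidef) :
    ∃ φ : MvPolynomial (Fin n) ℝ →ₗ[ℝ] EuclideanSpace ℝ (MultiIndex n s),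
      (∀ p q, p.totalDegree ≤ s → q.totalDegree ≤ s →
        inner ℝ (φ p) (φ q) = riesz y (p * q)) ∧
      LinearMap.range φ = (restrictTotalDegree (Fin n) ℝ s).map φ ∧
      ∀ k ≤ s, (momentMatrix k y).rank =
        Module.finrank ℝ ((restrictTotalDegree (Fin n) ℝ k).map φ) := by
  classical
  obtain ⟨v, hv⟩ := exists_gram_eq hy
  have hv' : ∀ α β, inner ℝ (v α) (v β) = y (α.1 + β.1) := fun α β =>
    (congrFun (congrFun hv α) β).symm
  -- Sending monomials of degree above s to 0 keeps the range of φ equal to the image of degree at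
  -- most s.
  let w : (Fin n →₀ ℕ) → EuclideanSpace ℝ (MultiIndex n s) := fun α =>
    if hα : α.degree ≤ s then v ⟨α, hα⟩ else 0
  let φ := (basisMonomials (Fin n) ℝ).constr ℝ w
  have hφ : ∀ α, φ (monomial α 1) = w α := (basisMonomials (Fin n) ℝ).constr_basis ℝ w
  have hw : ∀ α : MultiIndex n s, w α.1 = v α := fun α => dif_pos α.2
  have hmap : ∀ k ≤ s, (restrictTotalDegree (Fin n) ℝ k).map φ =
      Submodule.span ℝ (Set.range fun α : MultiIndex n k => w α.1) := by
    intro k hk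
    apply le_antisymm
    · rintro _ ⟨p, hp, rfl⟩
      rw [map_eq_sum_multiIndex φ ((mem_restrictTotalDegree _ _ _).mp hp)]
      refine Submodule.sum_mem _ fun β _ => Submodule.smul_mem _ _ (Submodule.subset_span ?_)
      exact ⟨β, (hφ _).symm⟩
    · rw [Submodule.span_le]
      rintro _ ⟨α, rfl⟩
      exact ⟨monomial α.1 1, (mem_restrictTotalDegree _ _ _).mpr
        ((totalDegree_monomial_one_le _).trans α.2), hφ _⟩
  refine ⟨φ, ?_, ?_, ?_⟩
  · intro p q hp hq
    rw [map_eq_sum_multiIndex φ hp, map_eq_sum_multiIndex φ hq,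
      ← dotProduct_momentMatrix_mulVec y hp hq]
    simp_rw [sum_inner, inner_sum, inner_smul_left, inner_smul_right, hφ, hw, hv']
    simp only [dotProduct, Matrix.mulVec, momentMatrix, Matrix.of_apply, Finset.mul_sum]
    refine Finset.sum_congr rfl fun α _ => Finset.sum_congr rfl fun β _ => ?_
    simp only [conj_trivial]; ring
  · refine le_antisymm ?_ (LinearMap.map_le_range)
    rw [hmap s le_rfl, Module.Basis.constr_range]
    rw [Submodule.span_le]
    rintro _ ⟨α, rfl⟩
    by_cases hα : α.degree ≤ s
    · exact Submodule.subset_span ⟨⟨α, hα⟩, rfl⟩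
    · have : w α = 0 := dif_neg hα
      rw [this]; exact Submodule.zero_mem _
  · intro k hk
    have hg : momentMatrix k y = Matrix.gram ℝ fun α : MultiIndex n k => w α.1 := by
      ext α β
      rw [Matrix.gram_apply, hw ⟨α.1, α.2.trans hk⟩, hw ⟨β.1, β.2.trans hk⟩, hv']
      rfl
    rw [hmap k hk, hg, rank_gram]

end Moment

/-! ### Flat moment matrices: atoms, interpolation, generated ideal. -/

section Flat

variable {n : ℕ}

/-- A flat positive semidefinite truncated moment matrix comes from a finitely atomic measure. -/
theorem exists_atoms_of_rank_eq {y : (Fin n →₀ ℕ) → ℝ} {s k : ℕ}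
    (hy : (momentMatrix s y).PosSemidef) (hks : k < s)
    (hr : (momentMatrix s y).rank = (momentMatrix k y).rank) :
    ∃ S : Finset (Fin n → ℝ), S.card = (momentMatrix s y).rank ∧
      (∀ p : MvPolynomial (Fin n) ℝ, p.totalDegree ≤ s →
        (p ∈ momentKernel s y ↔ ∀ γ ∈ S, eval γ p = 0)) ∧
      (∀ γ ∈ S, ∃ q : MvPolynomial (Fin n) ℝ, q.totalDegree ≤ k ∧ eval γ q = 1 ∧
        ∀ γ' ∈ S, γ' ≠ γ → eval γ' q = 0) ∧
      ∃ w : (Fin n → ℝ) → ℝ, (∀ γ ∈ S, 0 < w γ) ∧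
        ∀ p : MvPolynomial (Fin n) ℝ, p.totalDegree ≤ 2 * s →
          riesz y p = ∑ γ ∈ S, w γ * eval γ p := by
  classical
  obtain ⟨φ, hφ, hrange, hrank⟩ := exists_gram_representation hy
  have hmap : (restrictTotalDegree (Fin n) ℝ k).map φ = LinearMap.range φ := by
    refine Submodule.eq_of_le_of_finrank_eq LinearMap.map_le_range ?_
    rw [hrange, ← hrank s le_rfl, ← hrank k hks.le, hr]
  let ψ := φ.rangeRestrict
  have hψ : ∀ p q, p.totalDegree ≤ s → q.totalDegree ≤ s →
      inner ℝ (ψ p) (ψ q) = riesz y (p * q) := hφ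
  have hsurj : ∀ e, ∃ p, p.totalDegree ≤ k ∧ ψ p = e := by
    rintro ⟨e, he⟩
    rw [← hmap] at he
    obtain ⟨p, hp, rfl⟩ := he
    exact ⟨p, (mem_restrictTotalDegree _ _ _).mp hp, rfl⟩
  -- Only the drop to degree s - 1 is needed for the atoms; the sharper bound k survives in `hsurj`
  -- and bounds the interpolation polynomials.
  obtain ⟨f, hf, hfe⟩ := exists_atoms ψ (riesz y) (k := s - 1) (by omega) hψ (fun e => by
    obtain ⟨p, hp, hpe⟩ := hsurj e
    exact ⟨p, by omega, hpe⟩)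
  have hpos : ∀ γ ∈ f.support, 0 < inner ℝ (f γ) (f γ) := fun γ hγ =>
    real_inner_self_pos.mpr (Finsupp.mem_support_iff.mp hγ)
  have hin : ∀ γ ∈ f.support, ∀ p : MvPolynomial (Fin n) ℝ, p.totalDegree ≤ s →
      inner ℝ (f γ) (ψ p) = eval γ p * inner ℝ (f γ) (f γ) := by
    intro γ hγ p hp
    rw [hfe p hp, Finsupp.sum, inner_sum, Finset.sum_eq_single γ]
    · rw [inner_smul_right]
    · intro γ' _ hne
      rw [inner_smul_right, hf _ _ hne.symm, mul_zero]
    · exact fun h => absurd hγ h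
  have hker : ∀ p : MvPolynomial (Fin n) ℝ, p.totalDegree ≤ s →
      (p ∈ momentKernel s y ↔ ψ p = 0) := by
    intro p hp
    constructor
    · intro h
      rw [← inner_self_eq_zero (𝕜 := ℝ), hψ p p hp hp]
      exact riesz_mul_eq_zero_of_mem_momentKernel h hp
    · intro h
      refine mem_momentKernel_of_riesz_self hy hp ?_
      rw [← hψ p p hp hp, h, inner_zero_left]
  refine ⟨f.support, ?_, ?_, ?_, fun γ => inner ℝ (f γ) (f γ), hpos, ?_⟩
  · have hli : LinearIndependent ℝ fun γ : f.support => f γ.1 :=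
      linearIndependent_of_ne_zero_of_inner_eq_zero
        (fun γ => Finsupp.mem_support_iff.mp γ.2)
        (fun γ γ' hne => hf _ _ fun h => hne (Subtype.ext h))
    have hsp : ⊤ ≤ Submodule.span ℝ (Set.range fun γ : f.support => f γ.1) := by
      rintro e -
      obtain ⟨p, hp, rfl⟩ := hsurj e
      rw [hfe p (hp.trans hks.le)]
      exact Submodule.sum_mem _ fun γ hγ =>
        Submodule.smul_mem _ _ (Submodule.subset_span ⟨⟨γ, hγ⟩, rfl⟩)
    rw [hrank s le_rfl, ← hrange, Module.finrank_eq_card_basis (Module.Basis.mk hli hsp),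
      Fintype.card_coe]
  · intro p hp
    rw [hker p hp]
    constructor
    · intro h γ hγ
      have := hin γ hγ p hp
      rw [h, inner_zero_right] at this
      exact (mul_eq_zero.mp this.symm).resolve_right (hpos γ hγ).ne'
    · intro h
      rw [hfe p hp]
      exact Finset.sum_eq_zero fun γ hγ => by beta_reduce; rw [h γ hγ, zero_smul]
  · intro γ hγ
    -- By `hin`, pairing with `f γ'` reads off the value at γ'; orthogonality of the atoms makes a
    -- preimage of `f γ` interpolate.
    obtain ⟨q, hq, hqe⟩ := hsurj (f γ)
    refine ⟨q, hq, ?_, ?_⟩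
    · have := hin γ hγ q (hq.trans hks.le)
      rw [hqe] at this
      exact (mul_eq_right₀ (hpos γ hγ).ne').mp this.symm
    · intro γ' hγ' hne
      have := hin γ' hγ' q (hq.trans hks.le)
      rw [hqe, hf _ _ hne] at this
      exact (mul_eq_zero.mp this.symm).resolve_right (hpos γ' hγ').ne'
  · intro p hp
    let g : MvPolynomial (Fin n) ℝ →ₗ[ℝ] ℝ := ∑ γ ∈ f.support,
      (inner ℝ (f γ) (f γ) : ℝ) • (aeval γ : MvPolynomial (Fin n) ℝ →ₐ[ℝ] ℝ).toLinearMap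
    have hg : ∀ p, g p = ∑ γ ∈ f.support, inner ℝ (f γ) (f γ) * eval γ p := by
      intro p
      simp [g, LinearMap.sum_apply]
    rw [← hg]
    refine eq_of_eq_mul _ _ (fun p q hp hq => ?_) hp
    rw [hg, ← hψ p q hp hq]
    conv_lhs => rw [hfe p hp, Finsupp.sum, sum_inner]
    refine Finset.sum_congr rfl fun γ hγ => ?_
    rw [real_inner_smul_left, hin γ hγ q hq, map_mul]; ring

/-- A set of polynomials of degree at most `s` that is cut out by vanishing on a finite set `S`
interpolated in degree less than `s` generates the vanishing ideal of `S`. -/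
theorem span_eq_vanishingIdeal {S : Finset (Fin n → ℝ)} {s k : ℕ} (hks : k < s)
    {K : Set (MvPolynomial (Fin n) ℝ)}
    (hK : ∀ p : MvPolynomial (Fin n) ℝ, p.totalDegree ≤ s → (p ∈ K ↔ ∀ γ ∈ S, eval γ p = 0))
    (hdeg : ∀ p ∈ K, p.totalDegree ≤ s)
    (hq : ∀ γ ∈ S, ∃ q : MvPolynomial (Fin n) ℝ, q.totalDegree ≤ k ∧ eval γ q = 1 ∧
        ∀ γ' ∈ S, γ' ≠ γ → eval γ' q = 0) :
    Ideal.span K = vanishingIdeal ℝ (S : Set (Fin n → ℝ)) := by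
  classical
  have hle : Ideal.span K ≤ vanishingIdeal ℝ (S : Set (Fin n → ℝ)) := by
    rw [Ideal.span_le]
    intro p hp γ hγ
    exact (hK p (hdeg p hp)).mp hp γ hγ
  refine le_antisymm hle ?_
  -- every polynomial is congruent to one of degree at most `k`
  have hred : ∀ p : MvPolynomial (Fin n) ℝ, p.totalDegree ≤ s →
      ∃ r : MvPolynomial (Fin n) ℝ, r.totalDegree ≤ k ∧ p - r ∈ Ideal.span K := by
    intro p hp
    choose! q hqd hq1 hq0 using hq
    have hrd : (∑ γ ∈ S, eval γ p • q γ).totalDegree ≤ k :=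
      totalDegree_finsetSum_le fun γ hγ => (totalDegree_smul_le _ _).trans (hqd γ hγ)
    refine ⟨∑ γ ∈ S, eval γ p • q γ, hrd, Ideal.subset_span ?_⟩
    rw [hK _ (totalDegree_sub_le hp (hrd.trans hks.le))]
    intro γ hγ
    rw [map_sub, map_sum, Finset.sum_eq_single γ, smul_eval, hq1 γ hγ, mul_one, sub_self]
    · intro γ' hγ' hne
      rw [smul_eval, hq0 γ' hγ' γ hγ hne.symm, mul_zero]
    · exact fun h => absurd hγ h
  have hall : ∀ p : MvPolynomial (Fin n) ℝ,
      ∃ r : MvPolynomial (Fin n) ℝ, r.totalDegree ≤ k ∧ p - r ∈ Ideal.span K := by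
    intro p
    induction p using MvPolynomial.induction_on with
    | C a => exact hred _ (by simp)
    | add p q hp hq' =>
      obtain ⟨r, hr, hpr⟩ := hp
      obtain ⟨r', hr', hpr'⟩ := hq'
      refine ⟨r + r', (totalDegree_add _ _).trans (max_le hr hr'), ?_⟩
      rw [add_sub_add_comm]
      exact Ideal.add_mem _ hpr hpr'
    | mul_X p i hp =>
      obtain ⟨r, hr, hpr⟩ := hp
      obtain ⟨r', hr', hpr'⟩ := hred (X i * r) (totalDegree_X_mul_le i (by omega))
      refine ⟨r', hr', ?_⟩
      have : p * X i - r' = X i * (p - r) + (X i * r - r') := by ring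
      rw [this]
      exact Ideal.add_mem _ (Ideal.mul_mem_left _ _ hpr) hpr'
  intro p hp
  obtain ⟨r, hr, hpr⟩ := hall p
  have hr' : r ∈ Ideal.span K := by
    refine Ideal.subset_span ((hK r (hr.trans hks.le)).mpr fun γ hγ => ?_)
    have h1 := hle hpr γ hγ
    have h2 := hp γ hγ
    rw [map_sub, h2, zero_sub, neg_eq_zero] at h1
    exact h1
  simpa using Ideal.add_mem _ hpr hr'

theorem zeroLocus_complex_vanishingIdeal (S : Finset (Fin n → ℝ)) :
    zeroLocus ℂ (vanishingIdeal ℝ (S : Set (Fin n → ℝ))) =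
      (fun (x : Fin n → ℝ) (i : Fin n) => (x i : ℂ)) '' (S : Set (Fin n → ℝ)) := by
  classical
  apply Set.Subset.antisymm
  · intro z hz
    by_contra hne
    have hex : ∀ γ : S, ∃ i, (γ.1 i : ℂ) ≠ z i := by
      intro γ
      by_contra! h
      exact hne ⟨γ.1, γ.2, funext h⟩
    choose i hi using hex
    -- One linear factor per point, in a coordinate where that point differs from z: the product
    -- vanishes on S but not at z.
    have hmem : (∏ γ : S, (X (i γ) - C (γ.1 (i γ)))) ∈
        vanishingIdeal ℝ (S : Set (Fin n → ℝ)) := by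
      intro γ hγ
      rw [map_prod]
      exact Finset.prod_eq_zero (Finset.mem_univ ⟨γ, hγ⟩) (by simp)
    have h0 := hz _ hmem
    rw [map_prod, Finset.prod_eq_zero_iff] at h0
    obtain ⟨γ, -, h0⟩ := h0
    rw [map_sub, aeval_X, aeval_C, sub_eq_zero] at h0
    exact hi γ h0.symm
  · rintro _ ⟨γ, hγ, rfl⟩ p hp
    have h1 := aeval_algebraMap_apply ℂ γ p
    rw [hp γ hγ, map_zero] at h1
    exact h1

end Flat

/-! ### Feasible sequences and the effect of maximal rank. -/

section Feasible

variable {n m t : ℕ} {h : Fin m → MvPolynomial (Fin n) ℝ}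

theorem riesz_mul_eq_zero_of_mem_feasibleSet {y : MultiIndex n (2 * t) → ℝ}
    (hy : y ∈ feasibleSet h t) (j : Fin m) {p : MvPolynomial (Fin n) ℝ}
    (hp : p.totalDegree ≤ 2 * (t - halfDeg (h j))) : riesz (extend y) (h j * p) = 0 := by
  refine eq_of_eq_monomial (riesz (extend y) ∘ₗ LinearMap.mulLeft ℝ (h j)) 0 (fun α hα => ?_) hp
  obtain ⟨β, γ, hβ, hγ, rfl⟩ := exists_add_of_degree_le (t - halfDeg (h j)) (t - halfDeg (h j)) α
    (by omega)
  have := congrFun (congrFun (hy.2.2 j) ⟨β, hβ⟩) ⟨γ, hγ⟩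
  rw [momentMatrix, Matrix.of_apply, shift_apply] at this
  exact this

theorem totalDegree_le_two_mul_halfDeg (p : MvPolynomial (Fin n) ℝ) :
    p.totalDegree ≤ 2 * halfDeg p := by
  unfold halfDeg; omega

theorem halfDeg_le_maxHalfDeg (h : Fin m → MvPolynomial (Fin n) ℝ) (j : Fin m) :
    halfDeg (h j) ≤ maxHalfDeg h :=
  Finset.le_sup (f := fun j => halfDeg (h j)) (Finset.mem_univ j)

theorem midpoint_mem_feasibleSet {y z : MultiIndex n (2 * t) → ℝ} (hy : y ∈ feasibleSet h t)
    (hz : z ∈ feasibleSet h t) :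
    (1 / 2 : ℝ) • (y + z) ∈ feasibleSet h t ∧
      momentMatrix t (extend ((1 / 2 : ℝ) • (y + z))) =
        (1 / 2 : ℝ) • (momentMatrix t (extend y) + momentMatrix t (extend z)) := by
  have hext : extend ((1 / 2 : ℝ) • (y + z)) = (1 / 2 : ℝ) • (extend y + extend z) := by
    funext γ
    by_cases hγ : γ.degree ≤ 2 * t <;> simp [extend, hγ]
  have hmat : ∀ (k : ℕ) (a b : (Fin n →₀ ℕ) → ℝ),
      momentMatrix k ((1 / 2 : ℝ) • (a + b)) =
        (1 / 2 : ℝ) • (momentMatrix k a + momentMatrix k b) := fun _ _ _ => rfl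
  have hshift : ∀ (p : MvPolynomial (Fin n) ℝ) (a b : (Fin n →₀ ℕ) → ℝ),
      shift p ((1 / 2 : ℝ) • (a + b)) = (1 / 2 : ℝ) • (shift p a + shift p b) := by
    intro p a b
    funext α
    simp only [shift, Pi.smul_apply, Pi.add_apply, smul_eq_mul, ← Finset.sum_add_distrib,
      Finset.mul_sum]
    exact Finset.sum_congr rfl fun β _ => by ring
  refine ⟨⟨?_, ?_, fun j => ?_⟩, by rw [hext, hmat]⟩
  · rw [hext, Pi.smul_apply, Pi.add_apply, hy.1, hz.1]; norm_num
  · rw [hext, hmat]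
    exact (hy.2.1.add hz.2.1).smul (by norm_num)
  · rw [hext, hshift, hmat, hy.2.2 j, hz.2.2 j, add_zero, smul_zero]

/-- The truncated moment sequence of the point mass at `v`. -/
noncomputable def evalMoment (k : ℕ) (v : Fin n → ℝ) : MultiIndex n k → ℝ :=
  fun α => eval v (monomial α.1 1)

theorem extend_evalMoment {k : ℕ} (v : Fin n → ℝ) {α : Fin n →₀ ℕ} (hα : α.degree ≤ k) :
    extend (evalMoment k v) α = eval v (monomial α 1) :=
  dif_pos hα

theorem riesz_evalMoment {k : ℕ} (v : Fin n → ℝ) {p : MvPolynomial (Fin n) ℝ}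
    (hp : p.totalDegree ≤ k) : riesz (extend (evalMoment k v)) p = eval v p := by
  have := eq_of_eq_monomial (riesz (extend (evalMoment k v)))
    (aeval v : MvPolynomial (Fin n) ℝ →ₐ[ℝ] ℝ).toLinearMap
    (fun α hα => by rw [riesz_monomial, extend_evalMoment v hα]; rfl) hp
  rw [this]; rfl

theorem evalMoment_mem_feasibleSet (hd : ∀ j, halfDeg (h j) ≤ t) {v : Fin n → ℝ}
    (hv : ∀ j, eval v (h j) = 0) : evalMoment (2 * t) v ∈ feasibleSet h t := by
  refine ⟨?_, ?_, fun j => ?_⟩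
  · rw [extend_evalMoment v (by simp)]; simp
  · have : momentMatrix t (extend (evalMoment (2 * t) v)) =
        Matrix.vecMulVec (fun α : MultiIndex n t => eval v (monomial α.1 1))
          (star fun α : MultiIndex n t => eval v (monomial α.1 1)) := by
      ext α β
      have hdeg : (α.1 + β.1).degree ≤ 2 * t := by
        have := α.2; have := β.2; rw [map_add]; omega
      rw [momentMatrix, Matrix.of_apply, extend_evalMoment v hdeg, star_trivial,
        Matrix.vecMulVec_apply, ← map_mul, monomial_mul, one_mul]
    rw [this]
    exact Matrix.posSemidef_vecMulVec_self_star _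
  · ext α β
    rw [momentMatrix, Matrix.of_apply, shift_apply, riesz_evalMoment, map_mul, hv j, zero_mul,
      Matrix.zero_apply]
    refine (totalDegree_mul _ _).trans ?_
    have h1 := totalDegree_monomial_one_le (α.1 + β.1)
    have h2 := α.2
    have h3 := β.2
    have h4 := totalDegree_le_two_mul_halfDeg (h j)
    have h5 := hd j
    rw [map_add] at h1
    omega

/-- The kernel of a moment matrix of maximum rank vanishes on the variety. -/
theorem eval_eq_zero_of_mem_momentKernel (hd : ∀ j, halfDeg (h j) ≤ t)
    {y : MultiIndex n (2 * t) → ℝ} (hy : y ∈ feasibleSet h t)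
    (hmax : ∀ z ∈ feasibleSet h t,
      (momentMatrix t (extend z)).rank ≤ (momentMatrix t (extend y)).rank)
    {s : ℕ} (hst : s ≤ t) {p : MvPolynomial (Fin n) ℝ} (hp : p ∈ momentKernel s (extend y))
    {v : Fin n → ℝ} (hv : ∀ j, eval v (h j) = 0) : eval v p = 0 := by
  have hz := evalMoment_mem_feasibleSet hd hv
  obtain ⟨hmid, hmat⟩ := midpoint_mem_feasibleSet hy hz
  have hr := hmax _ hmid
  rw [hmat] at hr
  have hpt := momentKernel_mono hst hy.2.1 hp
  have hpz : p ∈ momentKernel t (extend (evalMoment (2 * t) v)) :=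
    ⟨hpt.1, mulVec_eq_zero_of_rank_midpoint_le hy.2.1 hz.2.1 hr hpt.2⟩
  have h0 := riesz_mul_eq_zero_of_mem_momentKernel hpz hpt.1
  rw [riesz_evalMoment v ((totalDegree_mul _ _).trans (by have := hpt.1; omega)), map_mul] at h0
  exact mul_self_eq_zero.mp h0

end Feasible

/-! ### Locating the atoms on the variety, and the conclusion. -/

section Main

variable {n m : ℕ} {h : Fin m → MvPolynomial (Fin n) ℝ}

theorem mem_zeroLocus_span_range {v : Fin n → ℝ} :
    v ∈ zeroLocus ℝ (Ideal.span (Set.range h)) ↔ ∀ j, eval v (h j) = 0 := by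
  rw [zeroLocus_span]
  exact ⟨fun H j => H _ ⟨j, rfl⟩, by rintro H _ ⟨j, rfl⟩; exact H j⟩

theorem eq_zero_of_maxHalfDeg_eq_zero {t : ℕ} (hd : maxHalfDeg h = 0)
    {y : MultiIndex n (2 * t) → ℝ} (hy : y ∈ feasibleSet h t) (j : Fin m) : h j = 0 := by
  have h0 : halfDeg (h j) = 0 := Nat.le_zero.mp (hd ▸ halfDeg_le_maxHalfDeg h j)
  have hdeg : (h j).totalDegree = 0 := by
    have := totalDegree_le_two_mul_halfDeg (h j); omega
  have hC := totalDegree_eq_zero_iff_eq_C.mp hdeg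
  have h1 := riesz_mul_eq_zero_of_mem_feasibleSet hy j (p := 1) (by simp)
  have h2 : h j * 1 = (h j).coeff 0 • monomial 0 (1 : ℝ) := by
    conv_lhs => rw [hC, mul_one]
    rw [smul_monomial, smul_eq_mul, mul_one]; rfl
  rw [h2, map_smul, riesz_monomial, hy.1, smul_eq_mul, mul_one] at h1
  rw [hC, h1, C_0]

/-- The atoms of a flat feasible sequence lie on the variety. -/
theorem eval_eq_zero_of_flat {t s : ℕ} (hst : s ≤ t) {y : MultiIndex n (2 * t) → ℝ}
    (hy : y ∈ feasibleSet h t) {S : Finset (Fin n → ℝ)}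
    (hK : ∀ p : MvPolynomial (Fin n) ℝ, p.totalDegree ≤ s →
        (p ∈ momentKernel s (extend y) ↔ ∀ γ ∈ S, eval γ p = 0))
    (hs : 2 * maxHalfDeg h ≤ s ∨ maxHalfDeg h ≤ s ∧
      (∀ γ ∈ S, ∃ q : MvPolynomial (Fin n) ℝ, q.totalDegree ≤ s - maxHalfDeg h ∧ eval γ q = 1 ∧
        ∀ γ' ∈ S, γ' ≠ γ → eval γ' q = 0) ∧
      ∃ w : (Fin n → ℝ) → ℝ, (∀ γ ∈ S, 0 < w γ) ∧
        ∀ p : MvPolynomial (Fin n) ℝ, p.totalDegree ≤ 2 * s →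
          riesz (extend y) p = ∑ γ ∈ S, w γ * eval γ p)
    {γ : Fin n → ℝ} (hγ : γ ∈ S) (j : Fin m) : eval γ (h j) = 0 := by
  have hj := totalDegree_le_two_mul_halfDeg (h j)
  have hjd := halfDeg_le_maxHalfDeg h j
  rcases hs with hs | ⟨hds, hq, w, hw, hL⟩
  -- From 2d ≤ s ≤ t follows s ≤ 2(t - d_j), so the constraint covers every q of degree at most s.
  · refine (hK (h j) (by omega)).mp (mem_momentKernel_of_riesz (by omega) fun q hq => ?_) γ hγ
    rw [mul_comm q]
    exact riesz_mul_eq_zero_of_mem_feasibleSet hy j (by omega)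
  · obtain ⟨q, hqd, hq1, hq0⟩ := hq γ hγ
    have hqq : (q * q).totalDegree ≤ 2 * (s - maxHalfDeg h) :=
      (totalDegree_mul _ _).trans (by omega)
    -- The degree of h_j q² is at most 2d + 2(s - d) = 2s, so the atomic formula applies and only
    -- the term w_γ h_j(γ) survives.
    have h0 := riesz_mul_eq_zero_of_mem_feasibleSet hy j (p := q * q) (by omega)
    rw [hL _ ((totalDegree_mul _ _).trans (by omega)), Finset.sum_eq_single γ] at h0
    · rw [map_mul, map_mul, hq1, mul_one, mul_one] at h0
      exact (mul_eq_zero.mp h0).resolve_left (hw γ hγ).ne'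
    · intro γ' hγ' hne
      rw [map_mul, map_mul, hq0 γ' hγ' hne, mul_zero, mul_zero, mul_zero]
    · exact fun hn => absurd hγ hn

end Main

end MomentRealRadical

open MvPolynomial MomentRealRadical in
theorem mainTheorem2 (n m : ℕ) (h : Fin m → MvPolynomial (Fin n) ℝ)
    (I : Ideal (MvPolynomial (Fin n) ℝ)) (hI : I = Ideal.span (Set.range h))
    (d : ℕ) (hd : d = maxHalfDeg h) (t : ℕ) (hdt : d ≤ t)
    (y : MultiIndex n (2 * t) → ℝ) (hy : y ∈ feasibleSet h t)
    (hmax : ∀ z ∈ feasibleSet h t,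
      (momentMatrix t (extend z)).rank ≤ (momentMatrix t (extend y)).rank)
    (s : ℕ) (hst : s ≤ t)
    (hs : (1 ≤ s ∧ 2 * d ≤ s ∧
        (momentMatrix s (extend y)).rank = (momentMatrix (s - 1) (extend y)).rank) ∨
      (d ≤ s ∧
        (momentMatrix s (extend y)).rank = (momentMatrix (s - d) (extend y)).rank)) :
    vanishingIdeal ℝ (zeroLocus ℝ I) = Ideal.span (momentKernel s (extend y)) ∧
    -- excluded below: the zero ideal in at least one variable, where the variety is infinite
    (n = 0 ∨ (∃ j, h j ≠ 0) →
      (zeroLocus ℝ I).encard = ((momentMatrix s (extend y)).rank : ℕ∞) ∧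
      zeroLocus ℂ (Ideal.span (momentKernel s (extend y))) =
        (fun (x : Fin n → ℝ) (i : Fin n) => (x i : ℂ)) '' zeroLocus ℝ I) := by
  subst hI hd
  have hd' : ∀ j, halfDeg (h j) ≤ t := fun j => (halfDeg_le_maxHalfDeg h j).trans hdt
  have hker : ∀ p ∈ momentKernel s (extend y), ∀ v ∈ zeroLocus ℝ (Ideal.span (Set.range h)),
      eval v p = 0 := fun p hp v hv =>
    eval_eq_zero_of_mem_momentKernel hd' hy hmax hst hp (mem_zeroLocus_span_range.mp hv)
  rcases Nat.eq_zero_or_pos (maxHalfDeg h) with hd0 | hdpos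
  · have hh : ∀ j, h j = 0 := eq_zero_of_maxHalfDeg_eq_zero hd0 hy
    have hV : ∀ v : Fin n → ℝ, v ∈ zeroLocus ℝ (Ideal.span (Set.range h)) := fun v =>
      mem_zeroLocus_span_range.mpr fun j => by rw [hh j, map_zero]
    have hbot : Ideal.span (momentKernel s (extend y)) = ⊥ := by
      rw [Ideal.span_eq_bot]
      exact fun p hp => MvPolynomial.funext fun v => by rw [hker p hp v (hV v), map_zero]
    have hvan : vanishingIdeal ℝ (zeroLocus ℝ (Ideal.span (Set.range h))) = ⊥ := by
      rw [eq_bot_iff]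
      intro p hp
      refine (Submodule.mem_bot _).mpr (MvPolynomial.funext fun v => ?_)
      rw [map_zero]
      exact hp v (hV v)
    refine ⟨by rw [hvan, hbot], ?_⟩
    rintro (rfl | ⟨j, hj⟩)
    · have huniv : zeroLocus ℝ (Ideal.span (Set.range h)) = Set.univ :=
        Set.eq_univ_of_forall hV
      -- Without variables the only monomial is 1, so the matrix is the single entry y_0 = 1.
      have hone : momentMatrix s (extend y) = 1 := by
        ext α β
        have hα : α.1 + β.1 = 0 := Subsingleton.elim _ _
        have hαβ : α = β := Subtype.ext (Subsingleton.elim _ _)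
        rw [momentMatrix, Matrix.of_apply, hα, hy.1, hαβ, Matrix.one_apply_eq]
      have hcard : Fintype.card (MultiIndex 0 s) = 1 := by
        rw [Fintype.card_eq_one_iff]
        exact ⟨⟨0, by simp⟩, fun α => Subtype.ext (Subsingleton.elim _ _)⟩
      refine ⟨?_, ?_⟩
      · rw [huniv, hone, Matrix.rank_one, hcard, Set.encard_univ, ENat.card_eq_coe_fintype_card]
        simp
      · rw [hbot, zeroLocus_bot, huniv]
        symm
        exact Set.eq_univ_of_forall fun z => ⟨0, trivial, Subsingleton.elim _ _⟩
    · exact absurd (hh j) hj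
  · obtain ⟨k, hks, hr, hsk⟩ : ∃ k < s,
        (momentMatrix s (extend y)).rank = (momentMatrix k (extend y)).rank ∧
        (2 * maxHalfDeg h ≤ s ∨ maxHalfDeg h ≤ s ∧ k = s - maxHalfDeg h) := by
      rcases hs with ⟨h1, h2, h3⟩ | ⟨h1, h2⟩
      · exact ⟨s - 1, by omega, h3, Or.inl h2⟩
      · exact ⟨s - maxHalfDeg h, by omega, h2, Or.inr ⟨h1, rfl⟩⟩
    obtain ⟨S, hcard, hK, hq, hw⟩ :=
      exists_atoms_of_rank_eq (posSemidef_momentMatrix_of_le hst hy.2.1) hks hr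
    have hspan := span_eq_vanishingIdeal hks hK (fun p hp => hp.1) hq
    have hsub : ∀ γ ∈ S, γ ∈ zeroLocus ℝ (Ideal.span (Set.range h)) := fun γ hγ =>
      mem_zeroLocus_span_range.mpr fun j => by
        refine eval_eq_zero_of_flat hst hy hK ?_ hγ j
        rcases hsk with hsk | ⟨hsk, rfl⟩
        · exact Or.inl hsk
        · exact Or.inr ⟨hsk, hq, hw⟩
    have hV : zeroLocus ℝ (Ideal.span (Set.range h)) = (S : Set (Fin n → ℝ)) := by
      refine Set.Subset.antisymm (fun v hv => ?_) hsub
      -- Since the kernel generates I(S) and vanishes at v, the point v is a zero of I(S), which has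
      -- no complex zeros outside S.
      have hz := zeroLocus_complex_vanishingIdeal S
      have hmem : (fun i => (v i : ℂ)) ∈
          zeroLocus ℂ (vanishingIdeal ℝ (S : Set (Fin n → ℝ))) := by
        rw [← hspan, zeroLocus_span]
        intro p hp
        have h1 := aeval_algebraMap_apply ℂ v p
        rw [show aeval v p = 0 from hker p hp v hv, map_zero] at h1
        exact h1
      rw [hz] at hmem
      obtain ⟨γ, hγ, hγv⟩ := hmem
      have : γ = v := _root_.funext fun i => Complex.ofReal_injective (congrFun hγv i)
      exact this ▸ hγ
    refine ⟨by rw [hV, hspan], fun _ => ⟨?_, ?_⟩⟩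
    · rw [hV, Set.encard_coe_eq_coe_finsetCard, hcard]
    · rw [hspan, hV, zeroLocus_complex_vanishingIdeal]
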